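/- Let $I=[l,r]$ with $l<r$, and let $f:I\to\mathbb R$ have bounded variation and be left-continuous at every point of $(l,r]$. Let $Df$ be the finite signed measure on $I$ determined by $Df([x,y))=f(y)-f(x)$ for $l\le x\le y\le r$ and $Df(\{r\})=0$; let $Df=f'\,dx+D^sf$ be its Lebesgue decomposition (absolutely continuous and singular part with respect to Lebesgue measure), and let $|D^sf|$ be the total variation measure of $D^sf$. Let $a:I\to[0,\infty)$ be $\alpha$-Hölder continuous with $\alpha>0$ (hence bounded), let $1<q<1+\alpha$, and set $\varphi(x,t):=t+a(x)t^q$ for $x\in I$, $t\ge 0$. Put $$\overline V^\varphi_I(f):=\limsup_{|(I_k)|\to0}\ \sum_{k=1}^n\Big(\sup_{x\in I_k}\varphi\Big(x,\tfrac{|f(a_k)-f(b_k)|}{|I_k|}\Big)\Big)|I_k|\in[0,\infty],$$ where $(I_k)_{k=1}^n$, $I_k=[a_k,b_k]$, runs over the partitions of $I$ into finitely many non-degenerate closed intervals with disjoint interiors, and $|(I_k)|:=\max_k|I_k|$. (1) If $\overline V^\varphi_I(f)<\infty$, then $|D^sf|(\{x\in I: a(x)>0\})=0$. (2) If $|D^sf|(\{x\in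 I: a(x)>0\})=0$ (in particular, by (1), whenever $\overline V^\varphi_I(f)<\infty$), then, as an equality in $[0,\infty]$, $$\overline V^\varphi_I(f)=\int_I |f'|+a(x)\,|f'|^q\,dx+|D^sf|(\{x\in I: a(x)=0\}).$$ -/

import Mathlib

open Set Filter Topology MeasureTheory
open scoped NNReal ENNReal

noncomputable section

/-- A partition of `[l, r]` into finitely many non-degenerate closed intervals
`[pt k, pt (k + 1)]` with disjoint interiors, given by its division points
`l = pt 0 < pt 1 < ⋯ < pt n = r`. -/
structure IntervalPartition (l r : ℝ) where
  /-- number of intervals -/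
  n : ℕ
  /-- division points -/
  pt : Fin (n + 1) → ℝ
  strictMono : StrictMono pt
  pt_zero : pt 0 = l
  pt_last : pt (Fin.last n) = r

namespace IntervalPartition

variable {l r : ℝ} (P : IntervalPartition l r)

/-- Left end-point of the `k`-th interval. -/
def left (k : Fin P.n) : ℝ := P.pt k.castSucc

/-- Right end-point of the `k`-th interval. -/
def right (k : Fin P.n) : ℝ := P.pt k.succ

/-- The `k`-th interval. -/
def interval (k : Fin P.n) : Set ℝ := Icc (P.left k) (P.right k)

/-- Length of the `k`-th interval. -/
def length (k : Fin P.n) : ℝ := P.right k - P.left k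

/-- The mesh of the partition: the maximal length of its intervals. -/
def mesh : ℝ := ⨆ k, P.length k

end IntervalPartition

/-- `φ⁺_A(t) = sup_{x ∈ A} φ(x, t)`. -/
def phiPlus (φ : ℝ → ℝ≥0 → ℝ≥0∞) (A : Set ℝ) (t : ℝ≥0) : ℝ≥0∞ := ⨆ x ∈ A, φ x t

/-- The Riesz sum `∑ₖ φ⁺_{I_k}(|Δ_k f| / |I_k|) |I_k|` of `f` over a partition `(I_k)`. -/
def rieszSum (φ : ℝ → ℝ≥0 → ℝ≥0∞) (f : ℝ → ℝ) {l r : ℝ} (P : IntervalPartition l r) : ℝ≥0∞ :=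
  ∑ k, phiPlus φ (P.interval k) ‖(f (P.left k) - f (P.right k)) / P.length k‖₊ *
    ENNReal.ofReal (P.length k)

/-- The limsup-version of the Riesz `φ`-variation of `f` on `[l, r]`: the limit superior of the
Riesz sums over the partitions of `[l, r]` as the mesh tends to `0`. -/
def upperRieszVariation (φ : ℝ → ℝ≥0 → ℝ≥0∞) (f : ℝ → ℝ) (l r : ℝ) : ℝ≥0∞ :=
  limsup (fun P : IntervalPartition l r ↦ rieszSum φ f P)
    (comap IntervalPartition.mesh (𝓝[>] (0 : ℝ)))

/-- The double phase function `φ(x, t) = t + a(x) t^q`. -/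
def doublePhase (a : ℝ → ℝ≥0) (q : ℝ) (x : ℝ) (t : ℝ≥0) : ℝ≥0∞ := ((t + a x * t ^ q : ℝ≥0) : ℝ≥0∞)

/-- The extension of a function on `[l, r]` to the real line that is constant, equal to `f l`, on
`(-∞, l]`, and constant, equal to `f r`, on `[r, ∞)`. -/
def constExtend (f : ℝ → ℝ) (l r : ℝ) (x : ℝ) : ℝ := f (max l (min r x))

theorem BoundedVariationOn.constExtend {f : ℝ → ℝ} {l r : ℝ}
    (hf : BoundedVariationOn f (Icc l r)) (hlr : l ≤ r) :
    BoundedVariationOn (constExtend f l r) univ := by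
  have h : eVariationOn (f ∘ fun x ↦ max l (min r x)) univ ≤ eVariationOn f (Icc l r) := by
    apply eVariationOn.comp_le_of_monotoneOn
    · intro x _ y _ hxy
      exact max_le_max le_rfl (min_le_min le_rfl hxy)
    · intro x _
      exact ⟨le_max_left _ _, max_le hlr (min_le_left _ _)⟩
  exact ne_top_of_le_ne_top hf h

/-- The derivative `Df` of a function `f` of bounded variation on `[l, r]`, as a finite signed
measure. When `f` is left-continuous it is concentrated on `[l, r)` and determined by
`Df([x, y)) = f y - f x` for `l ≤ x ≤ y ≤ r`; in particular its atom at `l` has mass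
`f(l+) - f(l)`. -/
def derivMeasure {f : ℝ → ℝ} {l r : ℝ} (hlr : l ≤ r) (hf : BoundedVariationOn f (Icc l r)) :
    SignedMeasure ℝ :=
  (hf.constExtend hlr).vectorMeasure

/-- `f'`: the density of the absolutely continuous part of `Df` with respect to Lebesgue
measure. -/
def acDeriv {f : ℝ → ℝ} {l r : ℝ} (hlr : l ≤ r) (hf : BoundedVariationOn f (Icc l r)) : ℝ → ℝ :=
  (derivMeasure hlr hf).rnDeriv volume

/-- `|D^s f|`: the total variation measure of the singular part `D^s f` of `Df` with respect to
Lebesgue measure. -/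
def singularVariation {f : ℝ → ℝ} {l r : ℝ} (hlr : l ≤ r) (hf : BoundedVariationOn f (Icc l r)) :
    Measure ℝ :=
  ((derivMeasure hlr hf).singularPart volume).totalVariation

end

/-! Write `V` for the total variation measure of `Df`. Since `V` has density `|f'|` plus the
singular part, and no atom at `r`, the claimed value is `V [l, r) + ∫ a |f'|^q` once the singular
part ignores `{a > 0}`. Two inequalities remain, and only the upper one needs that condition.

Lower bound (`le_upperRieszVariation`): a Riesz sum dominates `∑ |Δₖf|` plus `∫ a |stepQuot|^q`. The
liminf of the first term is at least `V [l, r)`, by testing `Df` against continuous functions close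
to its sign (`exists_eventually_lt_sum_mul_sub`). The second is handled by Fatou's lemma, because
the difference quotients converge a.e. to `f'` up to sign.

Upper bound (`phiPlus_mul_length_le`): on an interval of length `ℓ`, Hölder continuity gives `a ≤
min a + C ℓ^α`. If `min a > 0`, then `Df` is absolutely continuous there and Jensen's inequality
bounds the `min a` term by `∫ a |f'|^q`; if `min a = 0`, that term is absent. The oscillation term
is at most `C mesh^(1+α-q) V[l,r)^(q-1) V(cell)`. Its sum tends to `0` precisely because `q < 1 +
α`.

Vanishing on `{a > 0}` (`setIntegral_totalVariation_eq_zero`): the singular part lives on a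
Lebesgue-null set, so its sign is approximated by test functions of small Lebesgue mass. Truncating
the quotients at height `T`, the small quotients contribute little, and the large ones at most
`T^(1-q)` times the bounded Riesz sum. Let `T → ∞`. -/

namespace IntervalPartition

/-! ### Partitions, half-open cells and Riemann sums. -/

variable {l r : ℝ} (P : IntervalPartition l r)

theorem left_lt_right (k : Fin P.n) : P.left k < P.right k :=
  P.strictMono k.castSucc_lt_succ

theorem le_left (k : Fin P.n) : l ≤ P.left k :=
  P.pt_zero.symm.le.trans (P.strictMono.monotone (Fin.zero_le _))

theorem right_le (k : Fin P.n) : P.right k ≤ r :=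
  (P.strictMono.monotone (Fin.le_last _)).trans P.pt_last.le

theorem length_pos (k : Fin P.n) : 0 < P.length k :=
  sub_pos.2 (P.left_lt_right k)

theorem length_le_mesh (k : Fin P.n) : P.length k ≤ P.mesh :=
  le_ciSup (f := P.length) (Set.finite_range _).bddAbove k

theorem left_mem_interval (k : Fin P.n) : P.left k ∈ P.interval k :=
  left_mem_Icc.2 (P.left_lt_right k).le

theorem left_mem_Icc' (k : Fin P.n) : P.left k ∈ Icc l r :=
  ⟨P.le_left k, (P.left_lt_right k).le.trans (P.right_le k)⟩

theorem right_mem_Icc' (k : Fin P.n) : P.right k ∈ Icc l r :=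
  ⟨(P.le_left k).trans (P.left_lt_right k).le, P.right_le k⟩

theorem interval_subset (k : Fin P.n) : P.interval k ⊆ Icc l r :=
  Icc_subset_Icc (P.le_left k) (P.right_le k)

/-- The `k`-th interval of a partition, without its right end-point. -/
def cell (k : Fin P.n) : Set ℝ := Ico (P.left k) (P.right k)

theorem cell_subset_interval (k : Fin P.n) : P.cell k ⊆ P.interval k := Ico_subset_Icc_self

theorem measurableSet_cell (k : Fin P.n) : MeasurableSet (P.cell k) := measurableSet_Ico

theorem volume_cell (k : Fin P.n) : volume (P.cell k) = ENNReal.ofReal (P.length k) :=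
  Real.volume_Ico

theorem pairwise_disjoint_cell : Pairwise (Function.onFun Disjoint P.cell) := by
  have key : ∀ i j : Fin P.n, i < j → Disjoint (P.cell i) (P.cell j) := by
    intro i j hij
    refine Set.disjoint_left.2 fun x hxi hxj ↦ ?_
    have : P.right i ≤ P.left j := P.strictMono.monotone (Fin.succ_le_castSucc_iff.2 hij)
    exact absurd (hxi.2.trans_le (this.trans hxj.1)) (lt_irrefl _)
  intro i j hij
  rcases lt_or_gt_of_ne hij with h | h
  · exact key i j h
  · exact (key j i h).symm

theorem exists_mem_cell {x : ℝ} (hx : x ∈ Ico l r) : ∃ k, x ∈ P.cell k := by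
  by_contra! h
  have key : ∀ i : Fin (P.n + 1), P.pt i ≤ x := by
    intro i
    induction i using Fin.induction with
    | zero => exact P.pt_zero.le.trans hx.1
    | succ i ih =>
      by_contra! h'
      exact h i ⟨ih, h'⟩
  exact absurd ((key (Fin.last _)).trans_lt hx.2) (by rw [P.pt_last]; exact lt_irrefl _)

theorem iUnion_cell : ⋃ k, P.cell k = Ico l r := by
  refine Subset.antisymm (iUnion_subset fun k x hx ↦ ?_) fun x hx ↦
    mem_iUnion.2 (P.exists_mem_cell hx)
  exact ⟨(P.le_left k).trans hx.1, hx.2.trans_le (P.right_le k)⟩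

theorem cell_subset (k : Fin P.n) : P.cell k ⊆ Ico l r :=
  P.iUnion_cell ▸ subset_iUnion P.cell k

theorem sum_measure_cell (ν : Measure ℝ) : ∑ k, ν (P.cell k) = ν (Ico l r) := by
  rw [← P.iUnion_cell, measure_iUnion P.pairwise_disjoint_cell P.measurableSet_cell, tsum_fintype]

theorem sum_lintegral_cell (ν : Measure ℝ) (g : ℝ → ℝ≥0∞) :
    ∑ k, ∫⁻ x in P.cell k, g x ∂ν = ∫⁻ x in Ico l r, g x ∂ν := by
  rw [← P.iUnion_cell, lintegral_iUnion P.measurableSet_cell P.pairwise_disjoint_cell,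
    tsum_fintype]

theorem sum_integral_cell {ν : Measure ℝ} {g : ℝ → ℝ} (hg : IntegrableOn g (Ico l r) ν) :
    ∑ k, ∫ x in P.cell k, g x ∂ν = ∫ x in Ico l r, g x ∂ν := by
  rw [← P.iUnion_cell, integral_iUnion_fintype P.measurableSet_cell P.pairwise_disjoint_cell]
  exact fun k ↦ hg.mono_set (P.cell_subset k)

/-- The partition of `[l, r]` into `n + 1` intervals of equal length. -/
noncomputable def uniform (hlr : l < r) (n : ℕ) : IntervalPartition l r where
  n := n + 1
  pt i := l + (r - l) * (i / (n + 1))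
  strictMono i j hij := by
    have hn : (0 : ℝ) < n + 1 := by positivity
    have h : ((i : ℕ) : ℝ) < (j : ℕ) := by exact_mod_cast hij
    exact add_lt_add_right (mul_lt_mul_of_pos_left (div_lt_div_of_pos_right h hn)
      (sub_pos.2 hlr)) _
  pt_zero := by simp
  pt_last := by
    have : (n + 1 : ℝ) ≠ 0 := by positivity
    simp [div_self this]

theorem length_uniform (hlr : l < r) (n : ℕ) (k : Fin (n + 1)) :
    (uniform hlr n).length k = (r - l) / (n + 1) := by
  have : (n + 1 : ℝ) ≠ 0 := by positivity
  simp only [length, right, left, uniform, Fin.val_succ, Fin.val_castSucc]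
  push_cast
  field_simp
  ring

theorem mesh_uniform (hlr : l < r) (n : ℕ) : (uniform hlr n).mesh = (r - l) / (n + 1) := by
  have : Nonempty (Fin (uniform hlr n).n) := ⟨(0 : Fin (n + 1))⟩
  rw [mesh, funext (length_uniform hlr n)]
  exact ciSup_const

/-- The filter of partitions of `[l, r]` whose mesh tends to zero. -/
noncomputable abbrev fine (l r : ℝ) : Filter (IntervalPartition l r) := comap mesh (𝓝[>] (0 : ℝ))

/-- Uniform partitions have arbitrarily small mesh. This gives `liminf ≤ limsup` and lets eventual
properties be realised by an actual partition. -/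
theorem neBot_fine (hlr : l < r) : (fine l r).NeBot := by
  have h : Tendsto (fun n ↦ (uniform hlr n).mesh) atTop (𝓝[>] 0) := by
    refine tendsto_nhdsWithin_iff.2 ⟨?_, Eventually.of_forall fun n ↦ ?_⟩
    · simp_rw [mesh_uniform, div_eq_mul_one_div (r - l)]
      simpa using (tendsto_one_div_add_atTop_nhds_zero_nat (𝕜 := ℝ)).const_mul (r - l)
    · rw [mesh_uniform]
      have := sub_pos.2 hlr
      exact mem_Ioi.2 (by positivity)
  exact (tendsto_comap_iff.2 h : Tendsto (uniform hlr) atTop (fine l r)).neBot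

theorem tendsto_mesh_fine : Tendsto mesh (fine l r) (𝓝[>] 0) := tendsto_comap

theorem eventually_mesh_lt {δ : ℝ} (hδ : 0 < δ) : ∀ᶠ P in fine l r, P.mesh < δ :=
  (tendsto_mesh_fine.eventually (Ioo_mem_nhdsGT hδ)).mono fun _ h ↦ h.2

/-- Riemann sums, with respect to any finite measure, of a continuous function converge to its
integral. -/
theorem tendsto_sum_mul_measure_cell {g : ℝ → ℝ} (hg : ContinuousOn g (Icc l r)) (ν : Measure ℝ)
    [IsFiniteMeasureOnCompacts ν] :
    Tendsto (fun P : IntervalPartition l r ↦ ∑ k, g (P.left k) * ν.real (P.cell k)) (fine l r)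
      (𝓝 (∫ x in Ico l r, g x ∂ν)) := by
  have hint : IntegrableOn g (Ico l r) ν :=
    (hg.integrableOn_compact isCompact_Icc).mono_set Ico_subset_Icc_self
  have hfin : ν (Ico l r) ≠ ∞ :=
    ((measure_mono Ico_subset_Icc_self).trans_lt isCompact_Icc.measure_lt_top).ne
  rw [Metric.tendsto_nhds]
  intro ε hε
  obtain ⟨η, hη, hηε⟩ : ∃ η > 0, η * ν.real (Ico l r) < ε :=
    ⟨ε / (ν.real (Ico l r) + 1), by positivity, by
      rw [div_mul_eq_mul_div, div_lt_iff₀ (by positivity)]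
      nlinarith [measureReal_nonneg (μ := ν) (s := Ico l r)]⟩
  obtain ⟨δ, hδ, hgδ⟩ := Metric.uniformContinuousOn_iff.1
    (isCompact_Icc.uniformContinuousOn_of_continuous hg) η hη
  filter_upwards [eventually_mesh_lt hδ] with P hP
  have hcell (k) : ν (P.cell k) < ∞ := (measure_mono (P.cell_subset k)).trans_lt hfin.lt_top
  have hk (k) : ‖g (P.left k) * ν.real (P.cell k) - ∫ x in P.cell k, g x ∂ν‖ ≤
      η * ν.real (P.cell k) := by
    have h1 : g (P.left k) * ν.real (P.cell k) = ∫ _ in P.cell k, g (P.left k) ∂ν := by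
      rw [setIntegral_const, smul_eq_mul, mul_comm]
    have h2 : IntegrableOn (fun _ ↦ g (P.left k)) (P.cell k) ν :=
      integrableOn_const (hcell k).ne
    rw [h1, ← integral_sub h2
      (hint.mono_set (P.cell_subset k))]
    refine norm_setIntegral_le_of_norm_le_const (hcell k) fun x hx ↦ ?_
    rw [← dist_eq_norm]
    refine (hgδ _ (P.left_mem_Icc' k) _ (Ico_subset_Icc_self (P.cell_subset k hx)) ?_).le
    rw [Real.dist_eq, abs_sub_comm, abs_of_nonneg (sub_nonneg.2 hx.1)]
    exact (sub_lt_sub_right hx.2 _).trans_le ((P.length_le_mesh k).trans hP.le)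
  rw [← P.sum_integral_cell hint, Real.dist_eq, ← Finset.sum_sub_distrib]
  calc _ ≤ ∑ k, η * ν.real (P.cell k) :=
        (Finset.abs_sum_le_sum_abs _ _).trans (Finset.sum_le_sum fun k _ ↦ hk k)
    _ = η * ν.real (Ico l r) := by
        rw [← Finset.mul_sum]
        congr 1
        simp only [measureReal_def]
        rw [← ENNReal.toReal_sum fun k _ ↦ (hcell k).ne, P.sum_measure_cell]
    _ < ε := hηε

end IntervalPartition

/-! ### Differentiation of distribution functions and Lebesgue decomposition of the total variation.
-/

theorem tendsto_measureReal_Iio_nhdsGT (ν : Measure ℝ) [IsFiniteMeasure ν] (x : ℝ) :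
    Tendsto (fun y ↦ ν.real (Iio y)) (𝓝[>] x) (𝓝 (ν.real (Iic x))) := by
  have h := tendsto_measure_biInter_gt (μ := ν) (s := fun y : ℝ ↦ Iio y) (a := x)
    (fun _ _ ↦ measurableSet_Iio.nullMeasurableSet) (fun _ _ _ hij ↦ Iio_subset_Iio hij)
    ⟨x + 1, by simp, measure_ne_top _ _⟩
  have hI : ⋂ y > x, Iio y = Iic x := by
    ext z
    simpa using ⟨fun h ↦ le_of_forall_gt h, fun h i hi ↦ h.trans_lt hi⟩
  rw [hI] at h
  exact (ENNReal.tendsto_toReal (measure_ne_top _ _)).comp h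

/-- The right limits of `ν (Iio ·)` are `ν (Iic ·)`, so the Stieltjes measure of this monotone
function is `ν` itself, and a.e. differentiability of monotone functions applies. -/
theorem ae_hasDerivAt_measureReal_Iio (ν : Measure ℝ) [IsFiniteMeasure ν] :
    ∀ᵐ x, HasDerivAt (fun y ↦ ν.real (Iio y)) (ν.rnDeriv volume x).toReal x := by
  have hmono : Monotone fun y ↦ ν.real (Iio y) :=
    fun _ _ h ↦ measureReal_mono (Iio_subset_Iio h)
  have hν : hmono.stieltjesFunction.measure = ν := by
    refine (Measure.ext_of_Ioc _ _ fun a b hab ↦ ?_).symm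
    have hlim (x : ℝ) : hmono.stieltjesFunction x = ν.real (Iic x) :=
      rightLim_eq_of_tendsto (tendsto_measureReal_Iio_nhdsGT ν x)
    rw [StieltjesFunction.measure_Ioc, hlim, hlim, ← measureReal_sdiff
      (Iic_subset_Iic.2 hab.le) measurableSet_Iic, Iic_sdiff_Iic, ofReal_measureReal]
  simpa only [hν] using hmono.ae_hasDerivAt

namespace MeasureTheory.SignedMeasure

/-- The Jordan parts live on complementary sets, so at a.e. point one of the two densities vanishes
and no cancellation occurs. -/
theorem enorm_rnDeriv_ae_eq {α : Type*} {m : MeasurableSpace α} (s : SignedMeasure α)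
    (ν : Measure α) [SigmaFinite ν] :
    (fun x ↦ ‖s.rnDeriv ν x‖ₑ) =ᵐ[ν] fun x ↦ s.toJordanDecomposition.posPart.rnDeriv ν x +
      s.toJordanDecomposition.negPart.rnDeriv ν x := by
  obtain ⟨t, ht, ht₁, ht₂⟩ := s.toJordanDecomposition.mutuallySingular
  have key (ρ : Measure α) (u : Set α) (hu : MeasurableSet u) (h : ρ u = 0) :
      ∀ᵐ x ∂ν, x ∈ u → ρ.rnDeriv ν x = 0 := by
    refine (setLIntegral_eq_zero_iff hu (Measure.measurable_rnDeriv ρ ν)).1 ?_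
    exact le_antisymm ((Measure.setLIntegral_rnDeriv_le u).trans h.le) zero_le
  filter_upwards [key _ t ht ht₁, key _ tᶜ ht.compl ht₂,
    Measure.rnDeriv_lt_top s.toJordanDecomposition.posPart ν,
    Measure.rnDeriv_lt_top s.toJordanDecomposition.negPart ν] with x h₁ h₂ h₃ h₄
  rw [rnDeriv_def]
  by_cases hx : x ∈ t
  · simp [h₁ hx, Real.enorm_of_nonneg, ENNReal.ofReal_toReal h₄.ne]
  · simp [h₂ hx, Real.enorm_of_nonneg, ENNReal.ofReal_toReal h₃.ne]

theorem totalVariation_eq_withDensity_add {α : Type*} {m : MeasurableSpace α}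
    (s : SignedMeasure α) (ν : Measure α) [SigmaFinite ν] :
    s.totalVariation = ν.withDensity (fun x ↦ ‖s.rnDeriv ν x‖ₑ) +
      (s.singularPart ν).totalVariation := by
  rw [withDensity_congr_ae (s.enorm_rnDeriv_ae_eq ν), singularPart_totalVariation]
  erw [withDensity_add_left (Measure.measurable_rnDeriv _ _)]
  conv_lhs => rw [totalVariation, Measure.haveLebesgueDecomposition_add
      s.toJordanDecomposition.posPart ν, Measure.haveLebesgueDecomposition_add
      s.toJordanDecomposition.negPart ν]
  abel

end MeasureTheory.SignedMeasure

/-! ### The measure `Df`: increments, end-points, pointwise derivative. -/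

section derivMeasure

variable {f : ℝ → ℝ} {l r : ℝ}

theorem constExtend_of_mem {x : ℝ} (hx : x ∈ Icc l r) : constExtend f l r x = f x := by
  rw [constExtend, min_eq_right hx.2, max_eq_right hx.1]

theorem leftLim_constExtend (hleft : ∀ x ∈ Ioc l r, ContinuousWithinAt f (Iic x) x) {x : ℝ}
    (hx : x ∈ Icc l r) : (constExtend f l r).leftLim x = f x := by
  refine leftLim_eq_of_tendsto ?_
  rcases hx.1.eq_or_lt with rfl | h
  · refine tendsto_const_nhds.congr' ?_
    filter_upwards [self_mem_nhdsWithin] with y hy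
    rw [constExtend, min_eq_right ((le_of_lt hy).trans hx.2), max_eq_left (le_of_lt hy)]
  · refine ((hleft x ⟨h, hx.2⟩).mono_left (nhdsWithin_mono _ Iio_subset_Iic_self)).congr' ?_
    filter_upwards [Ioo_mem_nhdsLT h] with y hy
    rw [constExtend_of_mem ⟨hy.1.le, hy.2.le.trans hx.2⟩]

theorem derivMeasure_Ico (hlr : l ≤ r) (hf : BoundedVariationOn f (Icc l r))
    (hleft : ∀ x ∈ Ioc l r, ContinuousWithinAt f (Iic x) x) {x y : ℝ} (hx : x ∈ Icc l r)
    (hy : y ∈ Icc l r) (hxy : x ≤ y) : derivMeasure hlr hf (Ico x y) = f y - f x := by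
  rw [derivMeasure, BoundedVariationOn.vectorMeasure_Ico _ hxy, leftLim_constExtend hleft hx,
    leftLim_constExtend hleft hy]

theorem derivMeasure_singleton_right (hlr : l ≤ r) (hf : BoundedVariationOn f (Icc l r))
    (hleft : ∀ x ∈ Ioc l r, ContinuousWithinAt f (Iic x) x) :
    derivMeasure hlr hf {r} = 0 := by
  rw [derivMeasure, BoundedVariationOn.vectorMeasure_singleton,
    leftLim_constExtend hleft (right_mem_Icc.2 hlr), sub_eq_zero]
  refine rightLim_eq_of_tendsto (tendsto_const_nhds.congr' ?_)
  filter_upwards [self_mem_nhdsWithin] with y hy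
  rw [constExtend, min_eq_left (le_of_lt hy), max_eq_right hlr]

/-- A point lies on one side of the Hahn decomposition, so only one Jordan part can charge it. -/
theorem totalVariation_singleton {α : Type*} [MeasurableSpace α] [MeasurableSingletonClass α]
    (s : SignedMeasure α) (x : α) : s.totalVariation {x} = ‖s {x}‖ₑ := by
  obtain ⟨t, ht, ht₁, ht₂⟩ := s.toJordanDecomposition.mutuallySingular
  have h := s.apply_eq_posPart_real_sub_negPart_real (measurableSet_singleton x)
  rw [SignedMeasure.totalVariation, Measure.add_apply]
  by_cases hx : x ∈ t
  · have h0 := measure_mono_null (singleton_subset_iff.2 hx) ht₁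
    simp [h, measureReal_def, h0, Real.enorm_of_nonneg]
  · have h0 := measure_mono_null (singleton_subset_iff.2 (mem_compl hx)) ht₂
    simp [h, measureReal_def, h0, Real.enorm_of_nonneg]

theorem totalVariation_derivMeasure_Icc (hlr : l ≤ r) (hf : BoundedVariationOn f (Icc l r))
    (hleft : ∀ x ∈ Ioc l r, ContinuousWithinAt f (Iic x) x) :
    (derivMeasure hlr hf).totalVariation (Icc l r) =
      (derivMeasure hlr hf).totalVariation (Ico l r) := by
  refine le_antisymm ?_ (measure_mono Ico_subset_Icc_self)
  rw [← Ico_union_right hlr]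
  refine (measure_union_le _ _).trans ?_
  rw [totalVariation_singleton, derivMeasure_singleton_right hlr hf hleft, enorm_zero, add_zero]

theorem totalVariation_derivMeasure_apply (hlr : l ≤ r) (hf : BoundedVariationOn f (Icc l r))
    {s : Set ℝ} (hs : MeasurableSet s) :
    (derivMeasure hlr hf).totalVariation s =
      (∫⁻ x in s, ‖acDeriv hlr hf x‖ₑ) + singularVariation hlr hf s := by
  rw [SignedMeasure.totalVariation_eq_withDensity_add _ volume, Measure.add_apply,
    withDensity_apply _ hs]
  rfl

theorem singularVariation_le_totalVariation (hlr : l ≤ r) (hf : BoundedVariationOn f (Icc l r)) :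
    singularVariation hlr hf ≤ (derivMeasure hlr hf).totalVariation := by
  rw [SignedMeasure.totalVariation_eq_withDensity_add _ volume]
  exact Measure.le_add_left le_rfl

theorem measurable_acDeriv (hlr : l ≤ r) (hf : BoundedVariationOn f (Icc l r)) :
    Measurable (acDeriv hlr hf) :=
  SignedMeasure.measurable_rnDeriv _ _

theorem enorm_sub_le_totalVariation (hlr : l ≤ r) (hf : BoundedVariationOn f (Icc l r))
    (hleft : ∀ x ∈ Ioc l r, ContinuousWithinAt f (Iic x) x) {x y : ℝ} (hx : x ∈ Icc l r)
    (hy : y ∈ Icc l r) (hxy : x ≤ y) :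
    ‖f x - f y‖ₑ ≤ (derivMeasure hlr hf).totalVariation (Ico x y) := by
  rw [← enorm_neg, neg_sub, ← derivMeasure_Ico hlr hf hleft hx hy hxy]
  exact SignedMeasure.enorm_le_totalVariation _ _

theorem ae_hasDerivAt_acDeriv (hlr : l ≤ r) (hf : BoundedVariationOn f (Icc l r))
    (hleft : ∀ x ∈ Ioc l r, ContinuousWithinAt f (Iic x) x) :
    ∀ᵐ x, x ∈ Ioo l r → HasDerivAt f (acDeriv hlr hf x) x := by
  filter_upwards [ae_hasDerivAt_measureReal_Iio
      (derivMeasure hlr hf).toJordanDecomposition.posPart, ae_hasDerivAt_measureReal_Iio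
      (derivMeasure hlr hf).toJordanDecomposition.negPart] with x h₁ h₂ hx
  -- On `(l, r)`, `f` is the difference of the distribution functions of the Jordan parts, up to
  -- this constant.
  have h := (h₁.sub h₂).const_add (f l - (derivMeasure hlr hf (Iio l)))
  refine h.congr_of_eventuallyEq ?_
  filter_upwards [Ioo_mem_nhds hx.1 hx.2] with y hy
  have hl : derivMeasure hlr hf (Iio y) = derivMeasure hlr hf (Iio l) + (f y - f l) := by
    rw [← derivMeasure_Ico hlr hf hleft (left_mem_Icc.2 hlr) ⟨hy.1.le, hy.2.le⟩ hy.1.le,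
      ← VectorMeasure.of_union (by
        exact Set.disjoint_left.2 fun z hz hz' ↦ absurd hz (not_lt.2 hz'.1))
        measurableSet_Iio measurableSet_Ico, Iio_union_Ico_eq_Iio hy.1.le]
  have := (derivMeasure hlr hf).apply_eq_posPart_real_sub_negPart_real
    (measurableSet_Iio (a := y))
  simp only [Pi.sub_apply]
  linarith

end derivMeasure

/-! ### Testing `Df` against continuous approximations of its sign. -/

/-- Continuous functions are dense in `L¹`; truncation to `[-1, 1]` is 1-Lipschitz and fixes `h`, so
it does not worsen the approximation. -/
theorem exists_continuous_abs_le_one_integral_sub_le {ν : Measure ℝ} [IsFiniteMeasure ν]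
    {h : ℝ → ℝ} (hm : Measurable h) (h1 : ∀ x, |h x| ≤ 1) {ε : ℝ} (hε : 0 < ε) :
    ∃ g : ℝ → ℝ, Continuous g ∧ (∀ x, |g x| ≤ 1) ∧ ∫ x, |h x - g x| ∂ν ≤ ε := by
  have hint : Integrable h ν :=
    Integrable.of_bound hm.aestronglyMeasurable 1 (Eventually.of_forall h1)
  obtain ⟨g, hg, hgi⟩ := hint.exists_boundedContinuous_integral_sub_le hε
  refine ⟨fun x ↦ max (-1) (min 1 (g x)), by fun_prop, fun x ↦ abs_le.2
    ⟨le_max_left _ _, max_le (by norm_num) (min_le_left _ _)⟩, le_trans ?_ hg⟩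
  refine integral_mono_of_nonneg (Eventually.of_forall fun x ↦ abs_nonneg _)
    (hint.sub hgi).norm (Eventually.of_forall fun x ↦ ?_)
  have hx : h x = max (-1) (min 1 (h x)) := by
    rw [min_eq_right (abs_le.1 (h1 x)).2, max_eq_right (abs_le.1 (h1 x)).1]
  calc |h x - max (-1) (min 1 (g x))|
      = |max (-1) (min 1 (h x)) - max (-1) (min 1 (g x))| := by rw [← hx]
    _ ≤ |h x - g x| := by
        refine (abs_max_sub_max_le_max _ _ _ _).trans ?_
        rw [sub_self, abs_zero, max_eq_right (abs_nonneg _)]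
        refine (abs_min_sub_min_le_max _ _ _ _).trans ?_
        rw [sub_self, abs_zero, max_eq_right (abs_nonneg _)]

theorem MeasureTheory.SignedMeasure.exists_measurable_sign {α : Type*} {m : MeasurableSpace α}
    (s : SignedMeasure α) : ∃ h : α → ℝ, Measurable h ∧ (∀ x, |h x| ≤ 1) ∧
      (∀ᵐ x ∂s.toJordanDecomposition.posPart, h x = 1) ∧
      ∀ᵐ x ∂s.toJordanDecomposition.negPart, h x = -1 := by
  classical
  obtain ⟨t, ht, ht₁, ht₂⟩ := s.toJordanDecomposition.mutuallySingular
  refine ⟨t.piecewise (fun _ ↦ -1) fun _ ↦ 1, measurable_const.piecewise ht measurable_const,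
    fun x ↦ ?_, ?_, ?_⟩
  · by_cases hx : x ∈ t <;> simp [hx]
  · filter_upwards [measure_eq_zero_iff_ae_notMem.1 ht₁] with x hx using by simp [hx]
  · filter_upwards [measure_eq_zero_iff_ae_notMem.1 ht₂] with x hx using by
      simp [notMem_compl_iff.1 hx]

section

variable {f : ℝ → ℝ} {l r : ℝ}

theorem tendsto_sum_mul_sub (hlr : l ≤ r) (hf : BoundedVariationOn f (Icc l r))
    (hleft : ∀ x ∈ Ioc l r, ContinuousWithinAt f (Iic x) x) {g : ℝ → ℝ}
    (hg : ContinuousOn g (Icc l r)) :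
    Tendsto (fun P : IntervalPartition l r ↦ ∑ k, g (P.left k) * (f (P.right k) - f (P.left k)))
      (IntervalPartition.fine l r)
      (𝓝 (∫ x in Ico l r, g x ∂(derivMeasure hlr hf).toJordanDecomposition.posPart -
        ∫ x in Ico l r, g x ∂(derivMeasure hlr hf).toJordanDecomposition.negPart)) := by
  refine ((IntervalPartition.tendsto_sum_mul_measure_cell hg _).sub
    (IntervalPartition.tendsto_sum_mul_measure_cell hg _)).congr fun P ↦ ?_
  rw [← Finset.sum_sub_distrib]
  refine Finset.sum_congr rfl fun k _ ↦ ?_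
  rw [← derivMeasure_Ico hlr hf hleft (P.left_mem_Icc' k) (P.right_mem_Icc' k)
    (P.left_lt_right k).le, SignedMeasure.apply_eq_posPart_real_sub_negPart_real _
    measurableSet_Ico, mul_sub]
  rfl

/-- Testing `Df` against continuous functions `g` with `|g| ≤ 1` that approximate the sign of `Df`
on a set `S`, in terms of Riemann sums. -/
theorem exists_eventually_lt_sum_mul_sub (hlr : l ≤ r) (hf : BoundedVariationOn f (Icc l r))
    (hleft : ∀ x ∈ Ioc l r, ContinuousWithinAt f (Iic x) x) {w : ℝ → ℝ}
    (hw : ContinuousOn w (Icc l r)) {S : Set ℝ} (hS : MeasurableSet S) {ε : ℝ} (hε : 0 < ε) :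
    ∃ g : ℝ → ℝ, (∀ x, |g x| ≤ 1) ∧ ∀ᶠ P in IntervalPartition.fine l r,
      ∫ x in S ∩ Ico l r, w x ∂(derivMeasure hlr hf).totalVariation - ε <
        ∑ k, g (P.left k) * w (P.left k) * (f (P.right k) - f (P.left k)) ∧
      ∑ k, |g (P.left k)| * P.length k < volume.real (S ∩ Ico l r) + ε := by
  set μ := derivMeasure hlr hf
  set μp := μ.toJordanDecomposition.posPart
  set μn := μ.toJordanDecomposition.negPart
  obtain ⟨A, hA⟩ : ∃ A, ∀ x ∈ Icc l r, ‖w x‖ ≤ A := isCompact_Icc.exists_bound_of_continuousOn hw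
  have hA0 : 0 ≤ A := (norm_nonneg _).trans (hA l (left_mem_Icc.2 hlr))
  obtain ⟨δ, hδ, hδε, hAδ⟩ : ∃ δ > 0, δ < ε ∧ A * δ < ε := by
    refine ⟨ε / (A + 2), by positivity, div_lt_self hε (by linarith), ?_⟩
    rw [mul_div_assoc', div_lt_iff₀ (by positivity)]
    nlinarith
  obtain ⟨h, hhm, hh1, hhp, hhn⟩ := μ.exists_measurable_sign
  have hφm : Measurable (S.indicator h) := hhm.indicator hS
  have hφ1 : ∀ x, |S.indicator h x| ≤ 1 := fun x ↦ by
    by_cases hx : x ∈ S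
    · simpa [hx] using hh1 x
    · simp [hx]
  -- Approximating in `L¹` of the sum of the total variation and Lebesgue measure makes a single `g`
  -- serve both conclusions.
  obtain ⟨g, hgc, hg1, hgδ⟩ := exists_continuous_abs_le_one_integral_sub_le
    (ν := (μp + μn).restrict (Ico l r) + volume.restrict (Ico l r)) hφm hφ1 hδ
  have hb (ν : Measure ℝ) [IsFiniteMeasure ν] : Integrable (fun x ↦ |S.indicator h x - g x|) ν := by
    refine Integrable.of_bound (hφm.sub hgc.measurable).abs.aestronglyMeasurable 2
      (Eventually.of_forall fun x ↦ ?_)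
    rw [Real.norm_eq_abs, abs_abs]
    exact (abs_sub _ _).trans (by linarith [hφ1 x, hg1 x])
  rw [integral_add_measure (hb _) (hb _), Measure.restrict_add,
    integral_add_measure (hb _) (hb _)] at hgδ
  have hnn (ν : Measure ℝ) : 0 ≤ ∫ x, |S.indicator h x - g x| ∂ν :=
    integral_nonneg fun x ↦ abs_nonneg _
  refine ⟨g, hg1, ?_⟩
  have hwI (ν : Measure ℝ) [IsFiniteMeasure ν] : IntegrableOn w (Ico l r) ν :=
    (hw.integrableOn_compact isCompact_Icc).mono_set Ico_subset_Icc_self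
  have hmul (ν : Measure ℝ) [IsFiniteMeasure ν] {u : ℝ → ℝ} (hu : Measurable u)
      (hu1 : ∀ x, |u x| ≤ 1) : IntegrableOn (fun x ↦ u x * w x) (Ico l r) ν :=
    (hwI ν).bdd_mul hu.aestronglyMeasurable (Eventually.of_forall hu1)
  have hdiff (ν : Measure ℝ) [IsFiniteMeasure ν] :
      |∫ x in Ico l r, g x * w x ∂ν - ∫ x in Ico l r, S.indicator h x * w x ∂ν| ≤
        A * ∫ x in Ico l r, |S.indicator h x - g x| ∂ν := by
    rw [← integral_sub (hmul ν hgc.measurable hg1) (hmul ν hφm hφ1), ← integral_const_mul]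
    rw [← Real.norm_eq_abs]
    refine norm_integral_le_of_norm_le ((hb (ν.restrict (Ico l r))).const_mul A) ?_
    filter_upwards [ae_restrict_mem measurableSet_Ico] with x hx
    rw [← sub_mul, norm_mul, mul_comm, Real.norm_eq_abs (_ - _), abs_sub_comm]
    exact mul_le_mul_of_nonneg_right (hA x (Ico_subset_Icc_self hx)) (abs_nonneg _)
  have hconst (ν : Measure ℝ) (c : ℝ) (hc : ∀ᵐ x ∂ν, h x = c) :
      ∫ x in Ico l r, S.indicator h x * w x ∂ν = c * ∫ x in S ∩ Ico l r, w x ∂ν := by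
    rw [inter_comm, ← setIntegral_indicator hS, ← integral_const_mul]
    refine integral_congr_ae ?_
    filter_upwards [ae_restrict_of_ae hc] with x hx
    by_cases hxS : x ∈ S <;> simp [hxS, hx]
  have hlim₁ := tendsto_sum_mul_sub hlr hf hleft (hgc.continuousOn.mul hw)
  have hlim₂ := IntervalPartition.tendsto_sum_mul_measure_cell
    (hgc.abs.continuousOn (s := Icc l r)) volume
  refine (hlim₁.eventually (eventually_gt_nhds ?_)).and
    ((hlim₂.eventually (eventually_lt_nhds (b := volume.real (S ∩ Ico l r) + ε) ?_)).mono
      fun P hP ↦ ?_)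
  · have h₁ := abs_le.1 (hdiff μp)
    have h₂ := abs_le.1 (hdiff μn)
    rw [hconst μp 1 hhp] at h₁
    rw [hconst μn (-1) hhn] at h₂
    have h₃ : ∫ x in S ∩ Ico l r, w x ∂μ.totalVariation =
        ∫ x in S ∩ Ico l r, w x ∂μp + ∫ x in S ∩ Ico l r, w x ∂μn := by
      rw [SignedMeasure.totalVariation, Measure.restrict_add, integral_add_measure
        ((hwI _).mono_set inter_subset_right) ((hwI _).mono_set inter_subset_right)]
    have h₄ : A * ∫ x in Ico l r, |S.indicator h x - g x| ∂μp +
        A * ∫ x in Ico l r, |S.indicator h x - g x| ∂μn ≤ A * δ := by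
      rw [← mul_add]
      exact mul_le_mul_of_nonneg_left (by linarith [hnn (volume.restrict (Ico l r))]) hA0
    simp only [Pi.mul_apply]
    linarith [h₁.1, h₂.2]
  · have h₁ : ∫ x in Ico l r, |S.indicator h x| ≤ volume.real (S ∩ Ico l r) := by
      have : volume.real (S ∩ Ico l r) = ∫ x in Ico l r, S.indicator 1 x := by
        rw [setIntegral_indicator hS, inter_comm]
        simp
      rw [this]
      refine integral_mono_of_nonneg (Eventually.of_forall fun x ↦ abs_nonneg _)
        ((integrable_const 1).indicator hS) (Eventually.of_forall fun x ↦ ?_)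
      by_cases hx : x ∈ S
      · simpa [hx] using hh1 x
      · simp [hx]
    have h₂ : ∫ x in Ico l r, |g x| ≤
        ∫ x in Ico l r, (|S.indicator h x| + |S.indicator h x - g x|) := by
      refine integral_mono_of_nonneg (Eventually.of_forall fun x ↦ abs_nonneg _)
        (Integrable.add ?_ (hb _)) (Eventually.of_forall fun x ↦ ?_)
      · exact Integrable.of_bound hφm.abs.aestronglyMeasurable 1
          (Eventually.of_forall fun x ↦ by simpa using hφ1 x)
      · have := abs_sub (S.indicator h x) (S.indicator h x - g x)
        simpa using this
    rw [integral_add (Integrable.of_bound hφm.abs.aestronglyMeasurable 1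
      (Eventually.of_forall fun x ↦ by simpa using hφ1 x)) (hb _)] at h₂
    linarith [hnn (μp.restrict (Ico l r)), hnn (μn.restrict (Ico l r))]
  · refine lt_of_eq_of_lt (Finset.sum_congr rfl fun k _ ↦ ?_) hP
    rw [measureReal_def, P.volume_cell, ENNReal.toReal_ofReal (P.length_pos k).le]

end

/-! ### Lower bound for the Riesz sums. -/

theorem ENNReal.liminf_add_liminf_le {ι : Type*} {F : Filter ι} (u v : ι → ℝ≥0∞) :
    liminf u F + liminf v F ≤ liminf (fun i ↦ u i + v i) F := by
  rcases eq_or_ne (liminf u F) 0 with hu | hu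
  · rw [hu, zero_add]
    exact liminf_le_liminf (Eventually.of_forall fun i ↦ le_add_self)
  rcases eq_or_ne (liminf v F) 0 with hv | hv
  · rw [hv, add_zero]
    exact liminf_le_liminf (Eventually.of_forall fun i ↦ le_self_add)
  refine le_of_forall_lt fun c hc ↦ ?_
  obtain ⟨x, hx, y, hy, hxy⟩ := ENNReal.exists_lt_add_of_lt_add hc hu hv
  refine hxy.trans_le (le_liminf_of_le (by isBoundedDefault) ?_)
  filter_upwards [eventually_lt_of_lt_liminf hx, eventually_lt_of_lt_liminf hy] with i hi hi'
  exact add_le_add hi.le hi'.le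

section

variable {f : ℝ → ℝ} {l r : ℝ} {a : ℝ → ℝ≥0} {q : ℝ}

namespace IntervalPartition

/-- The difference quotient of `f` over the `k`-th interval of a partition, up to sign. -/
noncomputable def quot (P : IntervalPartition l r) (f : ℝ → ℝ) (k : Fin P.n) : ℝ :=
  (f (P.left k) - f (P.right k)) / P.length k

/-- The step function given by the difference quotients of `f` over the intervals of a
partition. -/
noncomputable def stepQuot (P : IntervalPartition l r) (f : ℝ → ℝ) (x : ℝ) : ℝ :=
  ∑ k, (P.cell k).indicator (fun _ ↦ P.quot f k) x

theorem measurable_stepQuot (P : IntervalPartition l r) (f : ℝ → ℝ) :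
    Measurable (P.stepQuot f) :=
  Finset.measurable_sum _ fun k _ ↦ measurable_const.indicator (P.measurableSet_cell k)

theorem stepQuot_of_mem (P : IntervalPartition l r) (f : ℝ → ℝ) {k : Fin P.n} {x : ℝ}
    (hx : x ∈ P.cell k) : P.stepQuot f x = P.quot f k := by
  rw [stepQuot, Finset.sum_eq_single_of_mem k (Finset.mem_univ _), indicator_of_mem hx]
  intro j _ hj
  exact indicator_of_notMem (fun h ↦ Set.disjoint_left.1 (P.pairwise_disjoint_cell hj) h hx) _

theorem enorm_quot_mul (P : IntervalPartition l r) (f : ℝ → ℝ) (k : Fin P.n) :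
    ‖P.quot f k‖ₑ * ENNReal.ofReal (P.length k) = ‖f (P.left k) - f (P.right k)‖ₑ := by
  rw [← Real.enorm_of_nonneg (P.length_pos k).le, ← enorm_mul, quot,
    div_mul_cancel₀ _ (P.length_pos k).ne']

/-- The end-points of the cell straddle `x`, so their distances to `x` add up to its length and the
two linearisation errors sum to at most `ε / 2` times that length. The sign comes from `quot`, which
subtracts right from left. -/
theorem tendsto_stepQuot {x d : ℝ} (hx : x ∈ Ico l r) (hd : HasDerivAt f d x) :
    Tendsto (fun P : IntervalPartition l r ↦ P.stepQuot f x) (fine l r) (𝓝 (-d)) := by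
  rw [Metric.tendsto_nhds]
  intro ε hε
  obtain ⟨δ, hδ, h⟩ := Metric.eventually_nhds_iff.1
    ((hasDerivAt_iff_isLittleO.1 hd).def (half_pos hε))
  filter_upwards [eventually_mesh_lt hδ] with P hP
  obtain ⟨k, hk⟩ := P.exists_mem_cell hx
  have hlen : P.right k - P.left k < δ := (P.length_le_mesh k).trans_lt hP
  have h₁ := h (y := P.left k) (by
    rw [Real.dist_eq, abs_sub_comm, abs_of_nonneg (sub_nonneg.2 hk.1)]; linarith [hk.2])
  have h₂ := h (y := P.right k) (by
    rw [Real.dist_eq, abs_of_nonneg (sub_nonneg.2 hk.2.le)]; linarith [hk.1])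
  rw [Real.norm_eq_abs, Real.norm_eq_abs, abs_of_nonpos (sub_nonpos.2 hk.1)] at h₁
  rw [Real.norm_eq_abs, Real.norm_eq_abs, abs_of_nonneg (sub_nonneg.2 hk.2.le)] at h₂
  simp only [smul_eq_mul] at h₁ h₂
  have hpos := P.length_pos k
  rw [P.stepQuot_of_mem f hk, Real.dist_eq, quot]
  have h₃ : (f (P.left k) - f (P.right k)) / P.length k - -d =
      (f (P.left k) - f (P.right k) + d * P.length k) / P.length k := by
    field_simp
    ring
  rw [h₃, abs_div, abs_of_pos hpos, div_lt_iff₀ hpos, abs_lt]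
  rw [abs_le] at h₁ h₂
  simp only [length] at hpos ⊢
  constructor <;> nlinarith [h₁.1, h₁.2, h₂.1, h₂.2, mul_pos hε hpos]

end IntervalPartition

open IntervalPartition

theorem doublePhase_le_phiPlus {A : Set ℝ} {x : ℝ} (hx : x ∈ A) (t : ℝ≥0) :
    doublePhase a q x t ≤ phiPlus (doublePhase a q) A t :=
  le_iSup₂_of_le x hx le_rfl

theorem doublePhase_eq (hq : 0 ≤ q) (x : ℝ) (t : ℝ≥0) :
    doublePhase a q x t = (t : ℝ≥0∞) + a x * (t : ℝ≥0∞) ^ q := by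
  rw [doublePhase, ENNReal.coe_add, ENNReal.coe_mul, ENNReal.coe_rpow_of_nonneg _ hq]

/-- The supremum over an interval dominates the average over its cell. Keeping `a x` under the
integral puts the sum in a form suited to Fatou's lemma. -/
theorem add_lintegral_le_rieszSum (hq : 0 ≤ q) (P : IntervalPartition l r) :
    ∑ k, ‖f (P.left k) - f (P.right k)‖ₑ + ∫⁻ x in Ico l r, a x * ‖P.stepQuot f x‖ₑ ^ q ≤
      rieszSum (doublePhase a q) f P := by
  rw [← P.sum_lintegral_cell volume, ← Finset.sum_add_distrib]
  refine Finset.sum_le_sum fun k _ ↦ ?_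
  rw [← P.enorm_quot_mul, ← P.volume_cell, ← setLIntegral_const, ← setLIntegral_const,
    ← lintegral_add_left measurable_const]
  refine setLIntegral_mono' (P.measurableSet_cell k) fun x hx ↦ ?_
  rw [P.stepQuot_of_mem f hx]
  exact (doublePhase_eq hq x _).symm.le.trans
    (doublePhase_le_phiPlus (P.cell_subset_interval k hx) _)

theorem totalVariation_le_liminf_sum (hlr : l < r) (hf : BoundedVariationOn f (Icc l r))
    (hleft : ∀ x ∈ Ioc l r, ContinuousWithinAt f (Iic x) x) :
    (derivMeasure hlr.le hf).totalVariation (Ico l r) ≤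
      liminf (fun P : IntervalPartition l r ↦ ∑ k, ‖f (P.left k) - f (P.right k)‖ₑ)
        (fine l r) := by
  set μ := derivMeasure hlr.le hf
  refine le_of_forall_lt fun c hc ↦ ?_
  obtain ⟨c', hcc', hc'⟩ := exists_between hc
  refine hcc'.trans_le (le_liminf_of_le (by isBoundedDefault) ?_)
  have hct : c' ≠ ∞ := hc'.ne_top
  have hlt : c'.toReal < μ.totalVariation.real (Ico l r) :=
    (ENNReal.toReal_lt_toReal hct (measure_ne_top _ _)).2 hc'
  obtain ⟨g, hg, h⟩ := exists_eventually_lt_sum_mul_sub hlr.le hf hleft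
    (w := fun _ ↦ 1) continuousOn_const MeasurableSet.univ (sub_pos.2 hlt)
  filter_upwards [h] with P hP
  have h₁ := hP.1
  simp only [univ_inter, setIntegral_const, smul_eq_mul, mul_one] at h₁
  have h₂ : c'.toReal ≤ ∑ k, |f (P.left k) - f (P.right k)| := by
    refine le_trans (by linarith) (Finset.sum_le_sum fun k _ ↦ ?_)
      (b := ∑ k, g (P.left k) * (f (P.right k) - f (P.left k)))
    refine (le_abs_self _).trans ?_
    rw [abs_mul, abs_sub_comm (f (P.right k))]
    exact mul_le_of_le_one_left (abs_nonneg _) (hg _)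
  calc c' = ENNReal.ofReal c'.toReal := (ENNReal.ofReal_toReal hct).symm
    _ ≤ ENNReal.ofReal (∑ k, |f (P.left k) - f (P.right k)|) := ENNReal.ofReal_le_ofReal h₂
    _ = _ := by
      rw [ENNReal.ofReal_sum_of_nonneg fun _ _ ↦ abs_nonneg _]
      exact Finset.sum_congr rfl fun k _ ↦ (Real.enorm_eq_ofReal_abs _).symm

theorem lintegral_le_liminf_lintegral_stepQuot (hlr : l < r) (hf : BoundedVariationOn f (Icc l r))
    (hleft : ∀ x ∈ Ioc l r, ContinuousWithinAt f (Iic x) x) (ha : ContinuousOn a (Icc l r)) :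
    ∫⁻ x in Ico l r, a x * ‖acDeriv hlr.le hf x‖ₑ ^ q ≤
      liminf (fun P : IntervalPartition l r ↦
        ∫⁻ x in Ico l r, a x * ‖P.stepQuot f x‖ₑ ^ q) (fine l r) := by
  have := neBot_fine hlr
  have ham : AEMeasurable (fun x ↦ (a x : ℝ≥0∞)) (volume.restrict (Ico l r)) :=
    ((ha.mono Ico_subset_Icc_self).aemeasurable measurableSet_Ico).coe_nnreal_ennreal
  refine le_trans (lintegral_mono_ae ?_) (lintegral_liminf_le' fun P ↦
    ham.mul ((P.measurable_stepQuot f).enorm.pow_const q).aemeasurable)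
  -- Differentiability is only available in the interior; `l` is Lebesgue-null.
  rw [restrict_Ioo_eq_restrict_Ico.symm, ae_restrict_iff' measurableSet_Ioo]
  filter_upwards [ae_hasDerivAt_acDeriv hlr.le hf hleft] with x h hx
  have hlim := tendsto_stepQuot (Ioo_subset_Ico_self hx) (h hx)
  have hlim' := ENNReal.Tendsto.const_mul (a := (a x : ℝ≥0∞))
    ((ENNReal.continuous_rpow_const (y := q)).tendsto _ |>.comp hlim.enorm)
    (Or.inr ENNReal.coe_ne_top)
  rw [enorm_neg] at hlim'
  exact hlim'.liminf_eq.symm.le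

theorem le_upperRieszVariation (hlr : l < r) (hf : BoundedVariationOn f (Icc l r))
    (hleft : ∀ x ∈ Ioc l r, ContinuousWithinAt f (Iic x) x) (ha : ContinuousOn a (Icc l r))
    (hq : 0 ≤ q) :
    (derivMeasure hlr.le hf).totalVariation (Ico l r) +
        ∫⁻ x in Ico l r, a x * ‖acDeriv hlr.le hf x‖ₑ ^ q ≤
      upperRieszVariation (doublePhase a q) f l r := by
  have := neBot_fine hlr
  calc _ ≤ _ := add_le_add (totalVariation_le_liminf_sum hlr hf hleft)
        (lintegral_le_liminf_lintegral_stepQuot hlr hf hleft ha)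
    _ ≤ _ := ENNReal.liminf_add_liminf_le _ _
    _ ≤ liminf (fun P : IntervalPartition l r ↦ rieszSum (doublePhase a q) f P) (fine l r) :=
        liminf_le_liminf (Eventually.of_forall fun P ↦ add_lintegral_le_rieszSum hq P)
    _ ≤ _ := liminf_le_limsup

/-! ### Vanishing of the singular part on `{a > 0}`. -/

/-- Truncation at height `T`: the first term covers `d ≤ T`, and superlinear growth gives the second
for `d > T`. -/
theorem mul_le_mul_add_rpow_mul {g d T : ℝ} (hg0 : 0 ≤ g) (hg1 : g ≤ 1) (hd : 0 ≤ d) (hT : 0 < T)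
    (hq : 1 < q) : g * d ≤ T * g + T ^ (1 - q) * d ^ q := by
  rcases le_or_gt d T with h | h
  · have : 0 ≤ T ^ (1 - q) * d ^ q := by positivity
    nlinarith
  · have hd' : 0 < d := hT.trans h
    have h₁ : d = d ^ (1 - q) * d ^ q := by
      rw [← Real.rpow_add hd', sub_add_cancel, Real.rpow_one]
    have h₂ : d ^ (1 - q) ≤ T ^ (1 - q) :=
      Real.rpow_le_rpow_of_nonpos hT h.le (by linarith)
    calc g * d ≤ d := mul_le_of_le_one_left hd hg1
      _ ≤ T ^ (1 - q) * d ^ q :=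
        h₁.le.trans (mul_le_mul_of_nonneg_right h₂ (by positivity))
      _ ≤ _ := le_add_of_nonneg_left (by positivity)

theorem sum_rpow_le_of_rieszSum_le (hq : 0 ≤ q) (P : IntervalPartition l r) {M : ℝ≥0}
    (hM : rieszSum (doublePhase a q) f P ≤ M) :
    ∑ k, a (P.left k) * |P.quot f k| ^ q * P.length k ≤ (M : ℝ) := by
  have hnn (k) : 0 ≤ (a (P.left k) : ℝ) * |P.quot f k| ^ q * P.length k := by
    have := P.length_pos k
    positivity
  have h : ENNReal.ofReal (∑ k, a (P.left k) * |P.quot f k| ^ q * P.length k) ≤ M := by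
    refine le_trans ?_ hM
    rw [ENNReal.ofReal_sum_of_nonneg fun k _ ↦ hnn k]
    refine Finset.sum_le_sum fun k _ ↦ ?_
    rw [ENNReal.ofReal_mul' (P.length_pos k).le]
    refine mul_le_mul_left (le_trans ?_ (doublePhase_le_phiPlus (P.left_mem_interval k) _)) _
    rw [doublePhase_eq hq, ENNReal.ofReal_mul (by positivity), ENNReal.ofReal_coe_nnreal,
      ← ENNReal.ofReal_rpow_of_nonneg (abs_nonneg _) hq, ← Real.enorm_eq_ofReal_abs]
    exact le_add_self
  exact (ENNReal.ofReal_le_iff_le_toReal ENNReal.coe_ne_top).1 h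

theorem setIntegral_totalVariation_eq_zero (hlr : l < r) (hf : BoundedVariationOn f (Icc l r))
    (hleft : ∀ x ∈ Ioc l r, ContinuousWithinAt f (Iic x) x) (ha : ContinuousOn a (Icc l r))
    (hq : 1 < q) (hV : upperRieszVariation (doublePhase a q) f l r < ∞) {S : Set ℝ}
    (hS : MeasurableSet S) (hS0 : volume S = 0) :
    ∫ x in S ∩ Ico l r, (a x : ℝ) ∂(derivMeasure hlr.le hf).totalVariation = 0 := by
  have := neBot_fine hlr
  have ha' : ContinuousOn (fun x ↦ (a x : ℝ)) (Icc l r) := NNReal.continuous_coe.comp_continuousOn ha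
  obtain ⟨M, hVM, -⟩ := ENNReal.lt_iff_exists_nnreal_btwn.1 hV
  obtain ⟨A, hA⟩ : ∃ A, ∀ x ∈ Icc l r, ‖(a x : ℝ)‖ ≤ A :=
    isCompact_Icc.exists_bound_of_continuousOn ha'
  have hA0 : 0 ≤ A := (norm_nonneg _).trans (hA l (left_mem_Icc.2 hlr.le))
  have hvol : volume.real (S ∩ Ico l r) = 0 := by
    rw [measureReal_def, measure_mono_null inter_subset_left hS0, ENNReal.toReal_zero]
  set L := ∫ x in S ∩ Ico l r, (a x : ℝ) ∂(derivMeasure hlr.le hf).totalVariation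
  have hT (T : ℝ) (hT : 0 < T) : L ≤ T ^ (1 - q) * M := by
    have key (ε : ℝ) (hε : 0 < ε) : L ≤ T ^ (1 - q) * M + (1 + T * A) * ε := by
      obtain ⟨g, hg, h⟩ := exists_eventually_lt_sum_mul_sub hlr.le hf hleft ha' hS hε
      -- One fine partition on which the test sum is nearly `L`, the test function has Lebesgue mass
      -- below `ε` (as `S` is null), and the Riesz sum is below `M`.
      obtain ⟨P, ⟨hP₁, hP₂⟩, hP₃⟩ := (h.and (eventually_lt_of_limsup_lt hVM)).exists
      rw [hvol, zero_add] at hP₂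
      have hP₄ := sum_rpow_le_of_rieszSum_le (zero_le_one.trans hq.le) P hP₃.le
      have h₁ : ∑ k, g (P.left k) * a (P.left k) * (f (P.right k) - f (P.left k)) ≤
          ∑ k, (T * A * (|g (P.left k)| * P.length k) +
            T ^ (1 - q) * (a (P.left k) * |P.quot f k| ^ q * P.length k)) := by
        refine Finset.sum_le_sum fun k _ ↦ ?_
        have hlen := P.length_pos k
        have h₂ : |f (P.right k) - f (P.left k)| = |P.quot f k| * P.length k := by
          rw [quot, abs_div, abs_of_pos hlen, div_mul_cancel₀ _ hlen.ne', abs_sub_comm]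
        have h₃ := mul_le_mul_add_rpow_mul (abs_nonneg (g (P.left k))) (hg _)
          (abs_nonneg (P.quot f k)) hT hq
        have h₄ : (a (P.left k) : ℝ) ≤ A := (le_abs_self _).trans (hA _ (P.left_mem_Icc' k))
        calc _ ≤ |g (P.left k) * a (P.left k) * (f (P.right k) - f (P.left k))| := le_abs_self _
          _ = (a (P.left k) * P.length k) * (|g (P.left k)| * |P.quot f k|) := by
            rw [abs_mul, abs_mul, h₂, NNReal.abs_eq]; ring
          _ ≤ (a (P.left k) * P.length k) *
              (T * |g (P.left k)| + T ^ (1 - q) * |P.quot f k| ^ q) :=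
            mul_le_mul_of_nonneg_left h₃ (by positivity)
          _ = a (P.left k) * (T * (|g (P.left k)| * P.length k)) +
              T ^ (1 - q) * (a (P.left k) * |P.quot f k| ^ q * P.length k) := by ring
          _ ≤ A * (T * (|g (P.left k)| * P.length k)) +
              T ^ (1 - q) * (a (P.left k) * |P.quot f k| ^ q * P.length k) := by gcongr
          _ = _ := by ring
      rw [Finset.sum_add_distrib, ← Finset.mul_sum, ← Finset.mul_sum] at h₁
      have h₂ : T * A * ∑ k, |g (P.left k)| * P.length k ≤ T * A * ε :=
        mul_le_mul_of_nonneg_left hP₂.le (by positivity)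
      have h₃ : T ^ (1 - q) * ∑ k, a (P.left k) * |P.quot f k| ^ q * P.length k ≤
          T ^ (1 - q) * M := mul_le_mul_of_nonneg_left hP₄ (by positivity)
      linarith
    refine le_of_forall_pos_le_add fun ε hε ↦ ?_
    have := key (ε / (1 + T * A)) (by positivity)
    rwa [mul_div_cancel₀ _ (by positivity)] at this
  refine le_antisymm ?_ (integral_nonneg fun x ↦ NNReal.coe_nonneg _)
  have hlim : Tendsto (fun T : ℝ ↦ T ^ (1 - q) * M) atTop (𝓝 0) := by
    have := (tendsto_rpow_neg_atTop (sub_pos.2 hq)).mul_const (M : ℝ)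
    simpa only [neg_sub, zero_mul] using this
  exact ge_of_tendsto hlim ((eventually_gt_atTop 0).mono hT)

/-- On a null set `S` carrying the singular part, `a ≥ 0` has zero integral against the total
variation over `[l, r)`, hence vanishes a.e. there; `r` carries no atom. -/
theorem singularVariation_pos_eq_zero (hlr : l < r) (hf : BoundedVariationOn f (Icc l r))
    (hleft : ∀ x ∈ Ioc l r, ContinuousWithinAt f (Iic x) x) (ha : ContinuousOn a (Icc l r))
    (hq : 1 < q) (hV : upperRieszVariation (doublePhase a q) f l r < ∞) :
    singularVariation hlr.le hf {x ∈ Icc l r | 0 < a x} = 0 := by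
  have hsing : singularVariation hlr.le hf ⟂ₘ volume := by
    rw [singularVariation, SignedMeasure.singularPart_totalVariation]
    exact (Measure.mutuallySingular_singularPart _ _).add_left
      (Measure.mutuallySingular_singularPart _ _)
  obtain ⟨S, hS, hS₁, hS₂⟩ := hsing.symm
  have hint := setIntegral_totalVariation_eq_zero hlr hf hleft ha hq hV hS hS₁
  have hle := singularVariation_le_totalVariation hlr.le hf
  set μ := derivMeasure hlr.le hf
  have ha' : ContinuousOn (fun x ↦ (a x : ℝ)) (Icc l r) := NNReal.continuous_coe.comp_continuousOn ha
  rw [setIntegral_eq_zero_iff_of_nonneg_ae (Eventually.of_forall fun x ↦ NNReal.coe_nonneg _)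
    ((ha'.integrableOn_compact isCompact_Icc).mono_set
      (inter_subset_right.trans Ico_subset_Icc_self))] at hint
  have hr : μ.totalVariation {r} = 0 := by
    rw [totalVariation_singleton, derivMeasure_singleton_right hlr.le hf hleft, enorm_zero]
  have h₁ : ∀ᵐ x ∂μ.totalVariation, x ∈ S ∩ Ico l r → (a x : ℝ) = 0 :=
    (ae_restrict_iff' (hS.inter measurableSet_Ico)).1 hint
  have h₂ := measure_eq_zero_iff_ae_notMem.1 hr
  have h₃ := measure_eq_zero_iff_ae_notMem.1 hS₂
  refine measure_eq_zero_iff_ae_notMem.2 ?_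
  filter_upwards [hle.absolutelyContinuous.ae_le h₁, hle.absolutelyContinuous.ae_le h₂, h₃] with
    x hx₁ hx₂ hx₃ hx
  have hxr : x < r := lt_of_le_of_ne hx.1.2 hx₂
  have := hx₁ ⟨notMem_compl_iff.1 hx₃, hx.1.1, hxr⟩
  exact hx.2.ne' (by exact_mod_cast this)

end

/-! ### Upper bound for the Riesz sums. -/

section

variable {f : ℝ → ℝ} {l r : ℝ} {a : ℝ → ℝ≥0} {q : ℝ}

open IntervalPartition

/-- Jensen's inequality for the power function `t ^ q`. -/
theorem rpow_mul_measure_le_lintegral_rpow {α : Type*} {m : MeasurableSpace α} {ν : Measure α}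
    (hν₀ : ν univ ≠ 0) (hν : ν univ ≠ ∞) {u : α → ℝ≥0∞} (hu : Measurable u) (hq : 1 ≤ q)
    {d : ℝ≥0∞} (hd : d * ν univ ≤ ∫⁻ x, u x ∂ν) :
    d ^ q * ν univ ≤ ∫⁻ x, u x ^ q ∂ν := by
  have hq0 : 0 < q := zero_lt_one.trans_le hq
  -- Comparing `L¹` and `L^q` norms and raising to the power `q` leaves a factor `ν univ ^ (q - 1)`
  -- on both sides, cancelled at the end.
  have h := eLpNorm'_le_eLpNorm'_mul_rpow_measure_univ (μ := ν) (f := u) zero_lt_one hq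
    hu.aestronglyMeasurable
  simp only [eLpNorm', enorm_eq_self, ENNReal.rpow_one, one_div, inv_one] at h
  have h₁ := ENNReal.rpow_le_rpow (hd.trans h) hq0.le
  rw [ENNReal.mul_rpow_of_nonneg _ _ hq0.le, ENNReal.mul_rpow_of_nonneg _ _ hq0.le,
    ← ENNReal.rpow_mul, ← ENNReal.rpow_mul, inv_mul_cancel₀ hq0.ne', ENNReal.rpow_one,
    sub_mul, one_mul, inv_mul_cancel₀ hq0.ne'] at h₁
  have h₂ : ν univ ^ q = ν univ * ν univ ^ (q - 1) := by
    conv_rhs => rw [← ENNReal.rpow_one (ν univ), ← ENNReal.rpow_mul, one_mul]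
    rw [← ENNReal.rpow_add _ _ hν₀ hν, add_sub_cancel]
  rw [h₂, ← mul_assoc] at h₁
  exact (ENNReal.mul_le_mul_iff_left (ENNReal.rpow_pos (pos_iff_ne_zero.2 hν₀) hν).ne'
    (ENNReal.rpow_ne_top_of_nonneg (by linarith) hν)).1 h₁

/-- If `c > 0`, the cell lies in `{a > 0}` and carries no singular mass, so the increment is at most
`∫ |f'|` and Jensen's inequality applies. Cells charged by the singular part force `c = 0`. -/
theorem mul_enorm_quot_rpow_le (hlr : l < r) (hf : BoundedVariationOn f (Icc l r))
    (hleft : ∀ x ∈ Ioc l r, ContinuousWithinAt f (Iic x) x) (hq : 1 ≤ q)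
    (hsing : singularVariation hlr.le hf {x ∈ Icc l r | 0 < a x} = 0)
    (P : IntervalPartition l r) (k : Fin P.n) {c : ℝ≥0} (hc : ∀ x ∈ P.interval k, c ≤ a x) :
    c * (‖P.quot f k‖ₑ ^ q * ENNReal.ofReal (P.length k)) ≤
      ∫⁻ x in P.cell k, a x * ‖acDeriv hlr.le hf x‖ₑ ^ q := by
  rcases eq_or_ne c 0 with rfl | hc0
  · simp
  have hD : singularVariation hlr.le hf (P.cell k) = 0 :=
    measure_mono_null (t := {x ∈ Icc l r | 0 < a x}) (fun x hx ↦
      ⟨P.interval_subset k (P.cell_subset_interval k hx),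
        (pos_iff_ne_zero.2 hc0).trans_le (hc x (P.cell_subset_interval k hx))⟩) hsing
  have hm := (measurable_acDeriv hlr.le hf).enorm
  have hvol : volume.restrict (P.cell k) univ = ENNReal.ofReal (P.length k) := by
    rw [Measure.restrict_apply_univ, P.volume_cell]
  have hjensen := rpow_mul_measure_le_lintegral_rpow (ν := volume.restrict (P.cell k))
    (d := ‖P.quot f k‖ₑ) (by simpa [hvol] using P.length_pos k) (by simp [hvol]) hm hq (by
      rw [hvol, P.enorm_quot_mul]
      refine (enorm_sub_le_totalVariation hlr.le hf hleft (P.left_mem_Icc' k)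
        (P.right_mem_Icc' k) (P.left_lt_right k).le).trans_eq ?_
      change (derivMeasure hlr.le hf).totalVariation (P.cell k) = _
      rw [totalVariation_derivMeasure_apply hlr.le hf (P.measurableSet_cell k), hD, add_zero])
  rw [hvol] at hjensen
  refine (mul_le_mul_right hjensen _).trans ?_
  rw [← lintegral_const_mul _ (hm.pow_const q)]
  refine setLIntegral_mono' (P.measurableSet_cell k) fun x hx ↦ ?_
  gcongr
  exact hc x (P.cell_subset_interval k hx)

theorem phiPlus_mul_length_le (hlr : l < r) (hf : BoundedVariationOn f (Icc l r))
    (hleft : ∀ x ∈ Ioc l r, ContinuousWithinAt f (Iic x) x) {C α : ℝ≥0}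
    (ha : HolderOnWith C α a (Icc l r)) (hq₁ : 1 < q) (hq : q < 1 + α)
    (hsing : singularVariation hlr.le hf {x ∈ Icc l r | 0 < a x} = 0)
    (P : IntervalPartition l r) (k : Fin P.n) :
    phiPlus (doublePhase a q) (P.interval k) ‖P.quot f k‖₊ * ENNReal.ofReal (P.length k) ≤
      (derivMeasure hlr.le hf).totalVariation (P.cell k) +
        (∫⁻ x in P.cell k, a x * ‖acDeriv hlr.le hf x‖ₑ ^ q) +
      C * ENNReal.ofReal P.mesh ^ (1 + α - q) *
        (derivMeasure hlr.le hf).totalVariation (Ico l r) ^ (q - 1) *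
          (derivMeasure hlr.le hf).totalVariation (P.cell k) := by
  set V := (derivMeasure hlr.le hf).totalVariation
  have hα : 0 < α := by
    have : (0 : ℝ) < α := by linarith
    exact_mod_cast this
  have hq0 : 0 < q := by linarith
  obtain ⟨x₀, hx₀, hmin⟩ := (isCompact_Icc (a := P.left k) (b := P.right k)).exists_isMinOn
    ⟨_, P.left_mem_interval k⟩ ((ha.continuousOn hα).mono (P.interval_subset k))
  set ℓ := ENNReal.ofReal (P.length k) with hℓ
  have hℓ0 : ℓ ≠ 0 := by simpa [hℓ] using P.length_pos k
  have hℓt : ℓ ≠ ∞ := ENNReal.ofReal_ne_top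
  set d : ℝ≥0∞ := ‖P.quot f k‖ₑ with hd
  have hdℓ : d * ℓ ≤ V (P.cell k) := by
    rw [hd, hℓ, P.enorm_quot_mul]
    exact enorm_sub_le_totalVariation hlr.le hf hleft (P.left_mem_Icc' k)
      (P.right_mem_Icc' k) (P.left_lt_right k).le
  have hosc (x : ℝ) (hx : x ∈ P.interval k) : (a x : ℝ≥0∞) ≤ a x₀ + C * ℓ ^ (α : ℝ) := by
    have h₁ : edist x x₀ ≤ ℓ := by
      rw [edist_dist]
      exact ENNReal.ofReal_le_ofReal (Real.dist_le_of_mem_Icc hx hx₀)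
    have h₂ := ha.edist_le (P.interval_subset k hx) (P.interval_subset k hx₀)
    have h₃ : (a x : ℝ≥0∞) ≤ a x₀ + edist (a x) (a x₀) := by
      rw [edist_nndist, ← ENNReal.coe_add, ENNReal.coe_le_coe, add_comm]
      exact NNReal.le_add_nndist _ _ |>.trans_eq (add_comm _ _)
    exact h₃.trans (add_le_add le_rfl (h₂.trans (by gcongr)))
  have hphi : phiPlus (doublePhase a q) (P.interval k) ‖P.quot f k‖₊ ≤
      d + (a x₀ + C * ℓ ^ (α : ℝ)) * d ^ q := by
    refine iSup₂_le fun x hx ↦ ?_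
    rw [doublePhase_eq hq0.le]
    exact add_le_add le_rfl (mul_le_mul_left (hosc x hx) _)
  have herr : ℓ ^ (α : ℝ) * d ^ q * ℓ ≤
      ENNReal.ofReal P.mesh ^ (1 + α - q) * V (Ico l r) ^ (q - 1) * V (P.cell k) := by
    -- Regroup so that the quotient appears only through the increment `d * ℓ ≤ V (P.cell k)`. One
    -- factor `d * ℓ` is kept to be summed over cells; the other `q - 1` are bounded by the total
    -- mass.
    have h₁ : ℓ ^ (α : ℝ) * d ^ q * ℓ = ℓ ^ (1 + α - q) * (d * ℓ) ^ q := by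
      have : ℓ ^ (α : ℝ) * ℓ = ℓ ^ (1 + α - q) * ℓ ^ q := by
        rw [← ENNReal.rpow_add _ _ hℓ0 hℓt, sub_add_cancel, add_comm,
          ENNReal.rpow_add _ _ hℓ0 hℓt, ENNReal.rpow_one]
      rw [ENNReal.mul_rpow_of_nonneg _ _ hq0.le, mul_right_comm, this]
      ring
    have h₂ : (d * ℓ) ^ q = (d * ℓ) ^ (q - 1) * (d * ℓ) := by
      conv_rhs => rw [← ENNReal.rpow_one (d * ℓ), ← ENNReal.rpow_mul, one_mul]
      rw [← ENNReal.rpow_add_of_nonneg _ _ (by linarith) zero_le_one, sub_add_cancel]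
    have h₃ : V (P.cell k) ≤ V (Ico l r) := measure_mono (P.cell_subset k)
    have h₄ : ℓ ≤ ENNReal.ofReal P.mesh := ENNReal.ofReal_le_ofReal (P.length_le_mesh k)
    rw [h₁, h₂, ← mul_assoc]
    gcongr
    exact hdℓ.trans h₃
  calc _ ≤ (d + (a x₀ + C * ℓ ^ (α : ℝ)) * d ^ q) * ℓ := mul_le_mul_left hphi _
    _ = d * ℓ + a x₀ * (d ^ q * ℓ) + C * (ℓ ^ (α : ℝ) * d ^ q * ℓ) := by ring
    _ ≤ _ := by
      rw [mul_assoc (C : ℝ≥0∞), mul_assoc (C : ℝ≥0∞)]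
      exact add_le_add (add_le_add hdℓ (mul_enorm_quot_rpow_le hlr hf hleft hq₁.le hsing P k hmin))
        (mul_le_mul_right herr _)

theorem upperRieszVariation_le (hlr : l < r) (hf : BoundedVariationOn f (Icc l r))
    (hleft : ∀ x ∈ Ioc l r, ContinuousWithinAt f (Iic x) x) {C α : ℝ≥0}
    (ha : HolderOnWith C α a (Icc l r)) (hq₁ : 1 < q) (hq : q < 1 + α)
    (hsing : singularVariation hlr.le hf {x ∈ Icc l r | 0 < a x} = 0) :
    upperRieszVariation (doublePhase a q) f l r ≤
      (derivMeasure hlr.le hf).totalVariation (Ico l r) +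
        ∫⁻ x in Ico l r, a x * ‖acDeriv hlr.le hf x‖ₑ ^ q := by
  have := neBot_fine hlr
  set V := (derivMeasure hlr.le hf).totalVariation
  have hβ : 0 < 1 + α - q := by linarith
  have hmesh : Tendsto (fun P : IntervalPartition l r ↦ ENNReal.ofReal P.mesh ^ (1 + α - q))
      (fine l r) (𝓝 0) := by
    have h : Tendsto (fun P : IntervalPartition l r ↦ ENNReal.ofReal P.mesh) (fine l r) (𝓝 0) := by
      simpa [Function.comp_def] using (ENNReal.continuous_ofReal.tendsto 0).comp
        ((tendsto_mesh_fine (l := l) (r := r)).mono_right nhdsWithin_le_nhds)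
    simpa [Function.comp_def, ENNReal.zero_rpow_of_pos hβ] using
      ((ENNReal.continuous_rpow_const (y := 1 + α - q)).tendsto 0).comp h
  have hV : V (Ico l r) ^ (q - 1) ≠ ∞ :=
    ENNReal.rpow_ne_top_of_nonneg (by linarith) (measure_ne_top _ _)
  have hlim : Tendsto (fun P : IntervalPartition l r ↦
      V (Ico l r) + (∫⁻ x in Ico l r, a x * ‖acDeriv hlr.le hf x‖ₑ ^ q) +
        C * ENNReal.ofReal P.mesh ^ (1 + α - q) * V (Ico l r) ^ (q - 1) * V (Ico l r))
      (fine l r) (𝓝 (V (Ico l r) + ∫⁻ x in Ico l r, a x * ‖acDeriv hlr.le hf x‖ₑ ^ q)) := by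
    have h₁ := ENNReal.Tendsto.const_mul (a := (C : ℝ≥0∞)) hmesh (Or.inr ENNReal.coe_ne_top)
    have h₂ := ENNReal.Tendsto.mul_const (ENNReal.Tendsto.mul_const h₁ (Or.inr hV))
      (Or.inr (measure_ne_top V (Ico l r)))
    simpa using h₂.const_add (V (Ico l r) + ∫⁻ x in Ico l r, a x * ‖acDeriv hlr.le hf x‖ₑ ^ q)
  refine (limsup_le_limsup (Eventually.of_forall fun P ↦ ?_)).trans hlim.limsup_eq.le
  refine (Finset.sum_le_sum fun k _ ↦
    phiPlus_mul_length_le hlr hf hleft ha hq₁ hq hsing P k).trans_eq ?_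
  rw [Finset.sum_add_distrib, Finset.sum_add_distrib, ← Finset.mul_sum, P.sum_measure_cell,
    P.sum_lintegral_cell]

end

theorem corollary1p3 {l r : ℝ} (hlr : l < r) {f : ℝ → ℝ} (hf : BoundedVariationOn f (Icc l r))
    (hleft : ∀ x ∈ Ioc l r, ContinuousWithinAt f (Iic x) x)
    {a : ℝ → ℝ≥0} {C α : ℝ≥0} (ha : HolderOnWith C α a (Icc l r))
    {q : ℝ} (hq₁ : 1 < q) (hq : q < 1 + α) :
    (upperRieszVariation (doublePhase a q) f l r < ∞ →
      singularVariation hlr.le hf {x ∈ Icc l r | 0 < a x} = 0) ∧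
    (singularVariation hlr.le hf {x ∈ Icc l r | 0 < a x} = 0 →
      upperRieszVariation (doublePhase a q) f l r =
        (∫⁻ x in Icc l r, (‖acDeriv hlr.le hf x‖ₑ + a x * ‖acDeriv hlr.le hf x‖ₑ ^ q)) +
          singularVariation hlr.le hf {x ∈ Icc l r | a x = 0}) := by
  have hα : 0 < α := by
    have : (0 : ℝ) < α := by linarith
    exact_mod_cast this
  have hac := ha.continuousOn hα
  refine ⟨singularVariation_pos_eq_zero hlr hf hleft hac hq₁, fun hsing ↦ ?_⟩
  have hD : singularVariation hlr.le hf (Icc l r) =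
      singularVariation hlr.le hf {x ∈ Icc l r | a x = 0} := by
    refine le_antisymm ?_ (measure_mono fun x hx ↦ hx.1)
    calc _ ≤ singularVariation hlr.le hf ({x ∈ Icc l r | a x = 0} ∪ {x ∈ Icc l r | 0 < a x}) :=
          measure_mono fun x hx ↦ (eq_zero_or_pos (a x)).imp (⟨hx, ·⟩) (⟨hx, ·⟩)
      _ ≤ _ := (measure_union_le _ _).trans_eq (by rw [hsing, add_zero])
  -- The bounds live on `[l, r)`; passing to `[l, r]` is free, since `r` is null for both Lebesgue
  -- measure and the total variation.
  rw [(upperRieszVariation_le hlr hf hleft ha hq₁ hq hsing).antisymm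
    (le_upperRieszVariation hlr hf hleft hac (by linarith)),
    ← totalVariation_derivMeasure_Icc hlr.le hf hleft,
    totalVariation_derivMeasure_apply hlr.le hf measurableSet_Icc, hD,
    lintegral_add_left (measurable_acDeriv hlr.le hf).enorm, restrict_Ico_eq_restrict_Icc]
  exact add_right_comm _ _ _
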